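/- Let $k$ be an algebraically closed field of characteristic $0$, let $X\subset\mathbb A^n_k$ be a smooth irreducible affine variety that is not a single point, and let $I\subset k[x_1,\dots,x_n]$ be the ideal of polynomials vanishing on $X$. Let $W_n=\bigoplus_{j=1}^n k[x_1,\dots,x_n]\,\frac{\partial}{\partial x_j}$ be the Lie algebra of polynomial vector fields on $\mathbb A^n_k$. Then the Lie algebra of polynomial vector fields on $X$, $$\mathcal D=\{\mu\in W_n \mid \mu(I)\subset I\}\,\big/\,\{\mu\in W_n\mid \mu(k[x_1,\dots,x_n])\subset I\}$$ (which is naturally isomorphic to $\mathrm{Der}_k(A)$ for $A=k[x_1,\dots,x_n]/I$), is simple as a Lie algebra over $k$: it is not abelian, and its only ideals are $0$ and $\mathcal D$. -/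

import Mathlib

noncomputable section

namespace AffineVariety

open MvPolynomial

variable {k : Type*} [Field k] {n : ℕ}

/-- A subset of affine space `k^n` is algebraic (Zariski closed) if it is the set of common zeros
of an ideal of polynomials. -/
def IsAlgebraic (X : Set (Fin n → k)) : Prop :=
  ∃ I : Ideal (MvPolynomial (Fin n) k), X = zeroLocus k I

/-- An irreducible affine variety in `k^n`: a non-empty algebraic set which is not the union of
two proper algebraic subsets. -/
structure IsIrreducibleVariety (X : Set (Fin n → k)) : Prop where
  isAlgebraic : IsAlgebraic X
  nonempty : X.Nonempty
  eq_or_eq_of_eq_union : ∀ Y Z : Set (Fin n → k), IsAlgebraic Y → IsAlgebraic Z →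
    X = Y ∪ Z → X = Y ∨ X = Z

/-- The algebra `A = k[x_1, …, x_n] / I` of polynomial functions on `X`, where `I` is the ideal
of all polynomials that vanish on `X`. -/
abbrev CoordinateRing (X : Set (Fin n → k)) : Type _ :=
  MvPolynomial (Fin n) k ⧸ vanishingIdeal k X

/-- The tangent space of `X` at `P`: the vectors `v` in `k^n` with
`∑ j, (∂f/∂x_j)(P) v_j = 0` for all `f` vanishing on `X`. -/
def tangentSpace (X : Set (Fin n → k)) (P : Fin n → k) : Submodule k (Fin n → k) where
  carrier := {v | ∀ f ∈ vanishingIdeal k X, ∑ j, eval P (pderiv j f) * v j = 0}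
  add_mem' {v w} hv hw f hf := by
    simp [mul_add, Finset.sum_add_distrib, hv f hf, hw f hf]
  zero_mem' f _ := by simp
  smul_mem' c v hv f hf := by
    simp [mul_left_comm _ c, ← Finset.mul_sum, hv f hf]

/-- An irreducible variety `X` is smooth if every point `P` of `X` is non-singular, that is, the
tangent space at `P` has the dimension of `X`. (For reducible `X` one would use the local
dimension at `P` instead.) -/
def IsSmooth (X : Set (Fin n → k)) : Prop :=
  ∀ P ∈ X, (Module.finrank k (tangentSpace X P) : WithBot ℕ∞) = ringKrullDim (CoordinateRing X)

/-- The Lie algebra `W_n` of polynomial vector fields `∑ j, g_j ∂/∂x_j` on `k^n`, that is, of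
`k`-derivations of `k[x_1, …, x_n]`, with the commutator as bracket. -/
abbrev W (k : Type*) [Field k] (n : ℕ) : Type _ :=
  Derivation k (MvPolynomial (Fin n) k) (MvPolynomial (Fin n) k)

/-- The subalgebra `{μ ∈ W_n | μ(I) ⊆ I}` of polynomial vector fields on `k^n` tangent to `X`,
where `I` is the ideal of polynomials vanishing on `X`. -/
def tangentFields (X : Set (Fin n → k)) : LieSubalgebra k (W k n) where
  carrier := {μ | ∀ f ∈ vanishingIdeal k X, μ f ∈ vanishingIdeal k X}
  add_mem' {μ ν} hμ hν f hf := add_mem (hμ f hf) (hν f hf)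
  zero_mem' _ _ := zero_mem _
  smul_mem' c μ hμ f hf := by
    rw [Derivation.smul_apply, smul_eq_C_mul]
    exact Ideal.mul_mem_left _ _ (hμ f hf)
  lie_mem' {μ ν} hμ hν f hf := by
    rw [Derivation.commutator_apply]
    exact sub_mem (hμ _ (hν f hf)) (hν _ (hμ f hf))

/-- The ideal `{μ ∈ W_n | μ(k[x_1, …, x_n]) ⊆ I}` of the Lie algebra `{μ ∈ W_n | μ(I) ⊆ I}`:
the vector fields on `k^n` that vanish along `X`. -/
def vanishingFields (X : Set (Fin n → k)) : LieIdeal k (tangentFields X) where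
  carrier := {μ | ∀ f, μ.1 f ∈ vanishingIdeal k X}
  add_mem' {μ ν} hμ hν f := add_mem (hμ f) (hν f)
  zero_mem' _ := zero_mem _
  smul_mem' c μ hμ f := by
    change (c • μ.1) f ∈ _
    rw [Derivation.smul_apply, smul_eq_C_mul]
    exact Ideal.mul_mem_left _ _ (hμ f)
  lie_mem {μ ν} hν f := by
    change ⁅μ.1, ν.1⁆ f ∈ _
    rw [Derivation.commutator_apply]
    exact sub_mem (μ.2 _ (hν f)) (hν _)

/-- The Lie algebra of polynomial vector fields on `X`: the subquotient
`{μ ∈ W_n | μ(I) ⊆ I} / {μ ∈ W_n | μ(k[x_1, …, x_n]) ⊆ I}` of `W_n`. -/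
abbrev PolyVectorFields (X : Set (Fin n → k)) : Type _ :=
  tangentFields X ⧸ vanishingFields X

end AffineVariety

end

/-! The Lie algebra in question is `Der A`, `A` the coordinate ring, and two facts make it simple.

If a domain `A` of characteristic 0 has no proper nonzero ideal stable under all derivations, then
`Der A` is simple once it is nonzero. From a nonzero `μ` in a Lie ideal `L`, brackets of multiples
of `μ` produce a nonzero `ν` with `A • ν ⊆ L`. Then `ν g` lies in `multiplierIdeal L`, which is
stable under derivations, hence contains 1, and `L` is everything
(`isSimple_of_isDerivationSimple`).

Smoothness makes `A` such a ring. By the Nullstellensatz a proper stable ideal `J` lies in the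
maximal ideal `m` of a point `P`. Bordered Jacobian minors give global fields `δ j` for which `E = ∑
(x_j - P_j) δ j` is the identity on `m / m ^ 2` (`exists_euler`), hence multiplication by `r` on `m
^ r / m ^ (r + 1)`. If `J ≤ m ^ r`, stability gives `E J ≤ m ^ (r + 1)`, so `J ≤ m ^ (r + 1)`;
Krull's intersection theorem yields `J = 0` (`eq_bot_of_euler`). -/

namespace Derivation

/-! ### Lie ideals of derivation algebras -/

section DerivationSimple

variable {k A : Type*} [Field k] [CommRing A] [Algebra k A]

/-- A commutative algebra is derivation-simple if its only ideals stable under all derivations are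
`0` and the whole algebra. -/
def IsDerivationSimple (k A : Type*) [Field k] [CommRing A] [Algebra k A] : Prop :=
  ∀ J : Ideal A, (∀ (δ : Derivation k A A), ∀ a ∈ J, δ a ∈ J) → J = ⊥ ∨ J = ⊤

lemma lie_smul_eq (μ τ : Derivation k A A) (f : A) : ⁅μ, f • τ⁆ = μ f • τ + f • ⁅μ, τ⁆ := by
  ext a
  simp only [commutator_apply, smul_apply, add_apply, leibniz, smul_eq_mul]
  ring

/-- The ideal of all functions `a` such that all multiples of `a` in the derivation module lie
in a given Lie ideal. -/
def multiplierIdeal (L : LieIdeal k (Derivation k A A)) : Ideal A where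
  carrier := {a | ∀ δ : Derivation k A A, a • δ ∈ L}
  add_mem' {a b} ha hb δ := by rw [add_smul]; exact add_mem (ha δ) (hb δ)
  zero_mem' δ := by rw [zero_smul]; exact zero_mem L
  smul_mem' c a ha δ := by rw [smul_eq_mul, mul_comm, mul_smul]; exact ha _

/-- Solve `⁅τ, a • δ⁆ = τ a • δ + a • ⁅τ, δ⁆` for the first term on the right. -/
lemma apply_mem_multiplierIdeal (L : LieIdeal k (Derivation k A A)) (τ : Derivation k A A)
    {a : A} (ha : a ∈ multiplierIdeal L) : τ a ∈ multiplierIdeal L := by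
  intro δ
  have h1 : ⁅τ, a • δ⁆ ∈ L := lie_mem_right k _ L _ _ (ha δ)
  rw [lie_smul_eq] at h1
  simpa using sub_mem h1 (ha ⁅τ, δ⁆)

lemma smul_lie_mem_of_smul_mem {L : LieIdeal k (Derivation k A A)} {ν : Derivation k A A}
    (hν : ∀ g : A, g • ν ∈ L) (τ : Derivation k A A) (g : A) : g • ⁅ν, τ⁆ ∈ L := by
  have h1 : ⁅τ, g • ν⁆ ∈ L := lie_mem_right k _ L _ _ (hν g)
  rw [lie_smul_eq] at h1
  have h2 : g • ⁅τ, ν⁆ ∈ L := by simpa using sub_mem h1 (hν (τ g))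
  rw [← lie_skew, smul_neg]
  exact neg_mem h2

lemma apply_mem_multiplierIdeal_of_smul_mem {L : LieIdeal k (Derivation k A A)}
    {ν : Derivation k A A} (hν : ∀ g : A, g • ν ∈ L) (f : A) : ν f ∈ multiplierIdeal L := by
  intro τ
  have h1 : ⁅ν, f • τ⁆ ∈ L := by simpa using smul_lie_mem_of_smul_mem hν (f • τ) 1
  rw [lie_smul_eq] at h1
  simpa using sub_mem h1 (smul_lie_mem_of_smul_mem hν τ f)

/-- With `h = μ f`, the brackets `⁅μ, (g * h) • μ⁆` and `⁅h • μ, g • μ⁆` share the term `(h * μ g) •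
μ`; their difference is twice the desired element. The second lies in `L` because `h • μ = ⁅μ, f •
μ⁆` does. -/
lemma smul_apply_apply_smul_mem [CharZero k] {L : LieIdeal k (Derivation k A A)}
    {μ : Derivation k A A} (hμ : μ ∈ L) (f g : A) : g • μ (μ f) • μ ∈ L := by
  have h0 : ∀ {η} (τ : Derivation k A A), η ∈ L → ⁅η, τ⁆ ∈ L := fun τ h =>
    lie_mem_left k _ L _ _ h
  have h1 : μ f • μ ∈ L := by simpa [lie_smul_eq] using h0 (f • μ) hμ
  have h2 := h0 (g • μ) h1
  have h3 := h0 ((g * μ f) • μ) hμ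
  have h4 : (2 : k)⁻¹ • (⁅μ, (g * μ f) • μ⁆ - ⁅μ f • μ, g • μ⁆) ∈ L :=
    L.smul_mem _ (sub_mem h3 h2)
  convert h4 using 1
  have : ⁅μ, (g * μ f) • μ⁆ - ⁅μ f • μ, g • μ⁆ = (2 : k) • (g • μ (μ f) • μ) := by
    ext a
    simp only [commutator_apply, smul_apply, sub_apply, leibniz, smul_eq_mul, two_smul, add_apply]
    ring
  rw [this, inv_smul_smul₀ two_ne_zero]

lemma exists_apply_apply_ne_zero [CharZero k] [IsDomain A] {μ : Derivation k A A} (hμ : μ ≠ 0) :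
    ∃ f, μ (μ f) ≠ 0 := by
  have : CharZero A := charZero_of_injective_algebraMap (algebraMap k A).injective
  by_contra! h
  refine hμ (ext fun f => ?_)
  -- If `μ ∘ μ = 0`, then `μ (μ (f * f))` reduces to `2 (μ f)²`.
  have h1 := h (f * f)
  simp only [leibniz, map_add, h f, smul_eq_mul, mul_zero, zero_add] at h1
  have h2 : (2 : A) * (μ f * μ f) = 0 := by linear_combination h1
  simpa using h2

/-- The Lie algebra of derivations of a derivation-simple domain over a field of characteristic
zero is simple. -/
theorem isSimple_of_isDerivationSimple [CharZero k] [IsDomain A] (hA : IsDerivationSimple k A)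
    (h0 : ∃ δ : Derivation k A A, δ ≠ 0) : LieAlgebra.IsSimple k (Derivation k A A) where
  eq_bot_or_eq_top L := by
    refine or_iff_not_imp_left.2 fun hL => ?_
    obtain ⟨μ, hμL, hμ⟩ : ∃ μ ∈ L, μ ≠ 0 := by
      by_contra! h
      exact hL ((LieSubmodule.eq_bot_iff L).2 h)
    obtain ⟨f, hf⟩ := exists_apply_apply_ne_zero hμ
    obtain ⟨g, hg⟩ : ∃ g, μ g ≠ 0 := by
      by_contra! h
      exact hμ (ext h)
    have hJ := apply_mem_multiplierIdeal_of_smul_mem (L := L) (ν := μ (μ f) • μ)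
      (fun g => smul_apply_apply_smul_mem hμL f g) g
    rcases hA (multiplierIdeal L) fun δ a ha => apply_mem_multiplierIdeal L δ ha with h | h
    · rw [h, Ideal.mem_bot] at hJ
      exact absurd hJ (mul_ne_zero hf hg)
    · refine le_antisymm le_top fun δ _ => ?_
      have h1 : (1 : A) ∈ multiplierIdeal L := h ▸ Submodule.mem_top
      simpa using h1 δ
  non_abelian h := by
    obtain ⟨μ, hμ⟩ := h0
    refine hμ (ext fun f => ?_)
    -- `⁅μ, f • μ⁆ = μ f • μ` takes the value `(μ f)²` at `f`.
    have h1 := congr($(h.trivial μ (f • μ)) f)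
    rw [lie_smul_eq, lie_self] at h1
    simpa using h1

end DerivationSimple

lemma finset_sum_apply {k R κ : Type*} [CommSemiring k] [CommSemiring R] [Algebra k R] (s : Finset κ)
    (D : κ → Derivation k R R) (g : R) : (∑ i ∈ s, D i) g = ∑ i ∈ s, D i g := by
  change coeFnAddMonoidHom (∑ i ∈ s, D i) g = _
  rw [map_sum, Finset.sum_apply]
  rfl

/-! ### Euler fields and stable ideals -/

section Euler

variable {k A : Type*} [Field k] [CommRing A] [Algebra k A]

/-- By the Leibniz rule, eigenvalues add on products: degree `r + 1` for a factor in `m ^ (r + 1)`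
and 1 for one in `m`. -/
lemma apply_sub_natCast_mul_mem_pow {m : Ideal A} {E : Derivation k A A}
    (hE : ∀ a ∈ m, E a - a ∈ m ^ 2) (r : ℕ) {a : A} (ha : a ∈ m ^ (r + 1)) :
    E a - (r + 1 : ℕ) * a ∈ m ^ (r + 2) := by
  induction r generalizing a with
  | zero => simpa using hE a (by simpa using ha)
  | succ r ih =>
    rw [pow_succ] at ha
    induction ha using Submodule.mul_induction_on' with
    | mem_mul_mem b hb c hc =>
      have h1 : (E b - (r + 1 : ℕ) * b) * c ∈ m ^ (r + 1 + 2) := by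
        rw [add_right_comm, pow_succ]; exact Ideal.mul_mem_mul (ih hb) hc
      have h2 : b * (E c - c) ∈ m ^ (r + 1 + 2) := by
        rw [pow_add]; exact Ideal.mul_mem_mul hb (hE c hc)
      convert add_mem h1 h2 using 1
      simp only [leibniz, smul_eq_mul]
      push_cast
      ring
    | add x _ y _ hx hy =>
      convert add_mem hx hy using 1
      rw [map_add]
      ring

/-- If a combination `∑ t_j ∂_j` with coefficients in a proper ideal `m` acts as the identity on
`m / m ^ 2`, then no nonzero ideal contained in `m` is stable under all `∂_j`. -/
theorem eq_bot_of_euler [CharZero k] [IsDomain A] [IsNoetherianRing A] {ι : Type*} [Fintype ι]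
    {m J : Ideal A} (hm : m ≠ ⊤) (hJm : J ≤ m) (t : ι → A) (ht : ∀ j, t j ∈ m)
    (δ : ι → Derivation k A A) (hδ : ∀ a ∈ m, ∑ j, t j * δ j a - a ∈ m ^ 2)
    (hJ : ∀ j, ∀ a ∈ J, δ j a ∈ J) : J = ⊥ := by
  set E : Derivation k A A := ∑ j, t j • δ j with hEdef
  have hE (a : A) : E a = ∑ j, t j * δ j a := by
    simp [hEdef, finset_sum_apply]
  have key (r : ℕ) : J ≤ m ^ (r + 1) := by
    induction r with
    | zero => simpa using hJm
    | succ r ih =>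
      intro a ha
      have h1 : E a ∈ m ^ (r + 2) := by
        rw [hE, pow_succ' m (r + 1)]
        exact sum_mem fun j _ => Ideal.mul_mem_mul (ht j) (ih (hJ j a ha))
      have h2 := apply_sub_natCast_mul_mem_pow (E := E) (fun a ha => hE a ▸ hδ a ha) r (ih ha)
      have h3 := sub_mem h1 h2
      rw [sub_sub_cancel] at h3
      -- Characteristic 0 enters here: the eigenvalue `r + 1` is invertible.
      convert Ideal.mul_mem_left _ (algebraMap k A ((r + 1 : ℕ) : k)⁻¹) h3 using 1
      rw [← mul_assoc, ← _root_.map_natCast (algebraMap k A), ← _root_.map_mul,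
        inv_mul_cancel₀ (Nat.cast_ne_zero.2 r.succ_ne_zero), _root_.map_one, one_mul]
  rw [eq_bot_iff, ← Ideal.iInf_pow_eq_bot_of_isDomain m hm]
  refine le_iInf fun r => ?_
  exact (key r).trans (Ideal.pow_le_pow_right r.le_succ)

end Euler
end Derivation

/-! ### Transport of simplicity -/

namespace LieAlgebra

/-- Simplicity of Lie algebras is invariant under isomorphism. -/
theorem IsSimple.of_equiv {k L L' : Type*} [CommRing k] [LieRing L] [LieAlgebra k L] [LieRing L']
    [LieAlgebra k L'] (e : L ≃ₗ⁅k⁆ L') (h : IsSimple k L') : IsSimple k L where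
  eq_bot_or_eq_top I := by
    rcases h.eq_bot_or_eq_top (LieIdeal.comap e.symm.toLieHom I) with h1 | h1
    · refine Or.inl ((LieSubmodule.eq_bot_iff I).2 fun x hx => ?_)
      have h2 : e x ∈ LieIdeal.comap e.symm.toLieHom I := by
        rw [LieIdeal.mem_comap]
        simpa using hx
      rw [h1, LieSubmodule.mem_bot] at h2
      simpa using h2
    · refine Or.inr (le_antisymm le_top fun x _ => ?_)
      have h2 : e x ∈ LieIdeal.comap e.symm.toLieHom I := h1 ▸ LieSubmodule.mem_top _
      rw [LieIdeal.mem_comap] at h2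
      simpa using h2
  non_abelian hL := h.non_abelian ⟨fun x y => e.symm.injective (by
    simp [hL.trivial])⟩

/-- If a Lie algebra homomorphism maps onto a simple Lie algebra, then the quotient by its kernel
is simple. -/
theorem IsSimple.quotient_ker {k L L' : Type*} [CommRing k] [LieRing L] [LieAlgebra k L]
    [LieRing L'] [LieAlgebra k L'] (f : L →ₗ⁅k⁆ L') (hf : Function.Surjective f)
    (h : IsSimple k L') : IsSimple k (L ⧸ f.ker) :=
  h.of_equiv (f.quotKerEquivRange.trans
    ((LieEquiv.ofEq f.range ⊤ (by rw [f.range_eq_top.2 hf])).trans LieSubalgebra.topEquiv))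

end LieAlgebra

noncomputable section
open MvPolynomial

namespace AffineVariety

/-! ### Cramer's rule and bordered determinants -/

section Cramer

variable {k V ι : Type*} [Field k] [AddCommGroup V] [Module k V] [Fintype ι] [DecidableEq ι]

/-- Cramer's rule: a functional in the span of `w` is determined by its values at the `u j`. -/
lemma det_mul_sub_sum_adjugate_eq_zero [FiniteDimensional k V]
    {N : Submodule k (Module.Dual k V)} (hN : Module.finrank k N = Fintype.card ι)
    {w : ι → Module.Dual k V} (hw : ∀ i, w i ∈ N) (u : ι → V)
    (hdet : (Matrix.of fun i j => w i (u j)).det ≠ 0) {φ : Module.Dual k V} (hφ : φ ∈ N) (v : V) :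
    (Matrix.of fun i j => w i (u j)).det * φ v -
      ∑ i, ∑ j, (Matrix.of fun i j => w i (u j)).adjugate j i * w i v * φ (u j) = 0 := by
  set M : Matrix ι ι k := Matrix.of fun i j => w i (u j) with hM
  have hli : LinearIndependent k w := by
    rw [Fintype.linearIndependent_iff]
    intro a ha
    have h1 : Matrix.vecMul a M = 0 := by
      ext j
      have h2 := congr($ha (u j))
      simpa [Matrix.vecMul, dotProduct, hM] using h2
    exact congr_fun (Matrix.eq_zero_of_vecMul_eq_zero hdet h1)
  have hspan : Submodule.span k (Set.range w) = N :=
    Submodule.eq_of_le_of_finrank_eq (Submodule.span_le.2 (Set.range_subset_iff.2 hw))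
      ((finrank_span_eq_card hli).trans hN.symm)
  obtain ⟨a, ha⟩ := (Submodule.mem_span_range_iff_exists_fun k).1 (hspan ▸ hφ)
  have hφa (x : V) : φ x = ∑ i, a i * w i x := by
    rw [← ha]
    exact LinearMap.sum_apply _ _ _
  have h3 (i : ι) : ∑ j, M.adjugate j i * w i v * φ (u j) = M.det * (a i * w i v) := by
    -- The vector `a M` lists the values of `φ` at the `u j`; multiplying by the adjugate recovers
    -- `a` up to `det M`.
    have h4 : Matrix.vecMul (Matrix.vecMul a M) M.adjugate i = M.det * a i := by
      rw [Matrix.vecMul_vecMul, Matrix.mul_adjugate, Matrix.vecMul_smul, Matrix.vecMul_one]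
      rfl
    rw [← mul_assoc, ← h4, Matrix.vecMul, dotProduct, Finset.sum_mul]
    refine Finset.sum_congr rfl fun j _ => ?_
    rw [hφa]
    simp only [Matrix.vecMul, dotProduct, hM, Matrix.of_apply]
    ring
  simp only [h3, ← Finset.mul_sum, ← hφa, sub_self]

/-- Linearly independent functionals on a finite-dimensional space have a dual family. -/
lemma exists_dual_family {k V ι : Type*} [Field k] [AddCommGroup V] [Module k V]
    [DecidableEq ι] [FiniteDimensional k V] {w : ι → Module.Dual k V} (hw : LinearIndependent k w) : ∃ u : ι → V, ∀ i j, w i (u j) = if i = j then 1 else 0 := by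
  have h1 (j : ι) : ∃ x : V, ∀ i, w i x = if i = j then 1 else 0 := by
    obtain ⟨g, hg⟩ := LinearMap.exists_extend ((Module.Basis.span hw).coord j)
    refine ⟨(Module.evalEquiv k V).symm g, fun i => ?_⟩
    rw [Module.apply_evalEquiv_symm_apply]
    have h2 := congr($hg (Module.Basis.span hw i))
    simpa [Module.Basis.span_apply, Finsupp.single_apply] using h2
  choose u hu using h1
  exact ⟨u, fun i j => hu j i⟩

/-- For derivations `D j`, `D₀` and elements `f i`, the derivation that sends `g` to the bordered
determinant of the matrix with rows `f i`, `g` and columns `D j`, `D₀`. -/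
def borderedDerivation {R : Type*} [CommRing R] [Algebra k R] (D : ι → Derivation k R R)
    (f : ι → R) (D₀ : Derivation k R R) : Derivation k R R :=
  (Matrix.of fun i j => D j (f i)).det • D₀ -
    ∑ i, ∑ j, ((Matrix.of fun i j => D j (f i)).adjugate j i * D₀ (f i)) • D j

lemma borderedDerivation_apply {R : Type*} [CommRing R] [Algebra k R] (D : ι → Derivation k R R)
    (f : ι → R) (D₀ : Derivation k R R) (g : R) :
    borderedDerivation D f D₀ g = (Matrix.of fun i j => D j (f i)).det * D₀ g -
      ∑ i, ∑ j, (Matrix.of fun i j => D j (f i)).adjugate j i * D₀ (f i) * D j g := by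
  simp only [borderedDerivation, Derivation.sub_apply, Derivation.smul_apply, smul_eq_mul,
    Derivation.finset_sum_apply]

end Cramer

/-! ### Differentials, Taylor expansion, conormal spaces -/

section Differential

variable {k : Type*} [Field k] {n : ℕ}

/-- The differential of a polynomial at a point. -/
def differential (P : Fin n → k) : MvPolynomial (Fin n) k →ₗ[k] Module.Dual k (Fin n → k) where
  toFun f := ∑ j, eval P (pderiv j f) • LinearMap.proj j
  map_add' f g := by simp [add_smul, Finset.sum_add_distrib]
  map_smul' c f := by simp [mul_smul, Finset.smul_sum]

lemma differential_apply (P : Fin n → k) (f : MvPolynomial (Fin n) k) (v : Fin n → k) :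
    differential P f v = ∑ j, eval P (pderiv j f) * v j := by
  simp [differential]

/-- The derivative in a constant direction. -/
def dirDeriv (v : Fin n → k) : Derivation k (MvPolynomial (Fin n) k) (MvPolynomial (Fin n) k) :=
  ∑ j, (C (v j) : MvPolynomial (Fin n) k) • pderiv j

lemma eval_dirDeriv (P v : Fin n → k) (f : MvPolynomial (Fin n) k) :
    eval P (dirDeriv v f) = differential P f v := by
  simp [dirDeriv, Derivation.finset_sum_apply, differential_apply, mul_comm]

lemma dirDeriv_single (j : Fin n) : dirDeriv (Pi.single j (1 : k)) = pderiv j := by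
  ext
  simp [dirDeriv, Pi.single_apply]

lemma eval_borderedDerivation {ι : Type*} [Fintype ι] [DecidableEq ι] (u : ι → Fin n → k)
    (f : ι → MvPolynomial (Fin n) k) (v Q : Fin n → k) (g : MvPolynomial (Fin n) k) :
    eval Q (borderedDerivation (fun i => dirDeriv (u i)) f (dirDeriv v) g) =
      (Matrix.of fun i j => differential Q (f i) (u j)).det * differential Q g v -
      ∑ i, ∑ j, (Matrix.of fun i j => differential Q (f i) (u j)).adjugate j i *
        differential Q (f i) v * differential Q g (u j) := by
  have h : (Matrix.of fun i j => differential Q (f i) (u j)) =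
      (eval Q).mapMatrix (Matrix.of fun i j => dirDeriv (u j) (f i)) := by
    ext i j
    simp [eval_dirDeriv]
  rw [borderedDerivation_apply, h, ← RingHom.map_det, ← RingHom.map_adjugate]
  simp [eval_dirDeriv]

/-- The first-order Taylor formula. -/
lemma sub_sum_sub_mem_sq (P : Fin n → k) (f : MvPolynomial (Fin n) k) :
    f - C (eval P f) - ∑ j, (X j - C (P j)) * C (eval P (pderiv j f)) ∈
      (vanishingIdeal k {P} : Ideal (MvPolynomial (Fin n) k)) ^ 2 := by
  set m : Ideal (MvPolynomial (Fin n) k) := vanishingIdeal k {P} with hm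
  have hX (j : Fin n) : X j - C (P j) ∈ m := by simp [hm]
  have hC (f : MvPolynomial (Fin n) k) : f - C (eval P f) ∈ m := by simp [hm, aeval_eq_eval]
  induction f using MvPolynomial.induction_on with
  | C a => simp
  | add p q hp hq =>
    convert add_mem hp hq using 1
    simp only [map_add, mul_add, Finset.sum_add_distrib]
    ring
  | mul_X p i hp =>
    have h1 : (p - C (eval P p)) * (X i - C (P i)) ∈ m ^ 2 := by
      rw [sq]; exact Ideal.mul_mem_mul (hC p) (hX i)
    convert add_mem h1 (Ideal.mul_mem_right (C (P i)) _ hp) using 1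
    have h2 : ∑ j, (X j - C (P j)) * C (eval P (pderiv j (p * X i))) =
        (X i - C (P i)) * C (eval P p) +
          (∑ j, (X j - C (P j)) * C (eval P (pderiv j p))) * C (P i) := by
      simp only [Derivation.leibniz, pderiv_X, smul_eq_mul, map_add, map_mul, eval_X,
        mul_add, Finset.sum_add_distrib]
      congr 1
      · rw [Finset.sum_eq_single i]
        · simp
        · intro j _ hj
          simp [hj.symm]
        · simp
      · rw [Finset.sum_mul]
        exact Finset.sum_congr rfl fun j _ => by ring
    rw [h2]
    simp only [map_mul, eval_X]
    ring

/-- The span of the differentials at `P` of the polynomials that vanish on `X`. -/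
def conormalSpace (X : Set (Fin n → k)) (P : Fin n → k) :
    Submodule k (Module.Dual k (Fin n → k)) :=
  ((vanishingIdeal k X).restrictScalars k).map (differential P)

lemma differential_mem_conormalSpace {X : Set (Fin n → k)} (P : Fin n → k)
    {f : MvPolynomial (Fin n) k} (hf : f ∈ vanishingIdeal k X) :
    differential P f ∈ conormalSpace X P :=
  Submodule.mem_map_of_mem (Submodule.restrictScalars_mem _ _ _ |>.2 hf)

lemma tangentSpace_eq_dualCoannihilator (X : Set (Fin n → k)) (P : Fin n → k) :
    tangentSpace X P = (conormalSpace X P).dualCoannihilator := by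
  ext v
  simp only [Submodule.mem_dualCoannihilator, conormalSpace, Submodule.mem_map,
    Submodule.restrictScalars_mem, forall_exists_index, and_imp, forall_apply_eq_imp_iff₂,
    differential_apply]
  rfl

lemma finrank_conormalSpace_add_finrank_tangentSpace (X : Set (Fin n → k)) (P : Fin n → k) :
    Module.finrank k (conormalSpace X P) + Module.finrank k (tangentSpace X P) = n := by
  rw [tangentSpace_eq_dualCoannihilator, Subspace.finrank_add_finrank_dualCoannihilator_eq]
  simp

/-- Smoothness enters the argument only through this constancy of the Jacobian rank. -/
lemma IsSmooth.finrank_conormalSpace_eq {X : Set (Fin n → k)} (h : IsSmooth X) {P Q : Fin n → k}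
    (hP : P ∈ X) (hQ : Q ∈ X) :
    Module.finrank k (conormalSpace X P) = Module.finrank k (conormalSpace X Q) := by
  have h1 : Module.finrank k (tangentSpace X P) = Module.finrank k (tangentSpace X Q) := by
    exact_mod_cast (h P hP).trans (h Q hQ).symm
  have h2 := finrank_conormalSpace_add_finrank_tangentSpace X P
  have h3 := finrank_conormalSpace_add_finrank_tangentSpace X Q
  omega

end Differential

/-! ### Tangent fields on a smooth variety -/

section Variety

variable {k : Type*} [Field k] {n : ℕ} {X : Set (Fin n → k)}

lemma IsAlgebraic.zeroLocus_vanishingIdeal (h : IsAlgebraic X) :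
    zeroLocus k (vanishingIdeal k X) = X := by
  obtain ⟨I, rfl⟩ := h
  exact zeroLocus_vanishingIdeal_galoisConnection.l_u_l_eq_l I

lemma IsAlgebraic.inter_setOf_eval_eq_zero (h : IsAlgebraic X) (f : MvPolynomial (Fin n) k) :
    IsAlgebraic {x ∈ X | aeval x f = 0} := by
  refine ⟨vanishingIdeal k X ⊔ Ideal.span {f}, ?_⟩
  have h1 := (zeroLocus_vanishingIdeal_galoisConnection (k := k) (K := k) (σ := Fin n)).l_sup
    (a₁ := vanishingIdeal k X) (a₂ := Ideal.span {f})
  rw [h1, h.zeroLocus_vanishingIdeal, zeroLocus_span]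
  ext x
  simp only [Set.mem_ofPred_eq, Set.mem_singleton_iff, forall_eq]
  rfl

lemma IsIrreducibleVariety.isPrime_vanishingIdeal (hX : IsIrreducibleVariety X) :
    (vanishingIdeal k X).IsPrime := by
  refine Ideal.isPrime_iff.2 ⟨fun h => ?_, fun {f g} hfg => ?_⟩
  · obtain ⟨x, hx⟩ := hX.nonempty
    have h1 : (1 : MvPolynomial (Fin n) k) ∈ vanishingIdeal k X := h ▸ Submodule.mem_top
    simpa using h1 x hx
  · have hu : X = {x ∈ X | aeval x f = 0} ∪ {x ∈ X | aeval x g = 0} := by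
      ext x
      have := hfg x
      simp only [map_mul, mul_eq_zero] at this
      simp only [Set.mem_union, Set.mem_ofPred_eq]
      tauto
    rcases hX.eq_or_eq_of_eq_union _ _ (hX.isAlgebraic.inter_setOf_eval_eq_zero f)
      (hX.isAlgebraic.inter_setOf_eval_eq_zero g) hu with h | h
    · exact Or.inl fun x hx => (h ▸ hx : x ∈ {x ∈ X | aeval x f = 0}).2
    · exact Or.inr fun x hx => (h ▸ hx : x ∈ {x ∈ X | aeval x g = 0}).2

/-- On a smooth variety, the bordered determinants of the Jacobian matrix, with as many rows of
equations as the codimension, are vector fields tangent to the variety. -/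
lemma borderedDerivation_mem_tangentFields (hX : IsIrreducibleVariety X) (hs : IsSmooth X)
    {ι : Type*} [Fintype ι] [DecidableEq ι] {P : Fin n → k} (hP : P ∈ X)
    (hcard : Module.finrank k (conormalSpace X P) = Fintype.card ι)
    {f : ι → MvPolynomial (Fin n) k} (hf : ∀ i, f i ∈ vanishingIdeal k X) (u : ι → Fin n → k)
    (hdet : (Matrix.of fun i j => differential P (f i) (u j)).det ≠ 0) (v : Fin n → k) :
    borderedDerivation (fun i => dirDeriv (u i)) f (dirDeriv v) ∈ tangentFields X := by
  intro g hg
  set Δ : MvPolynomial (Fin n) k := (Matrix.of fun i j => dirDeriv (u j) (f i)).det with hΔ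
  have hev (Q : Fin n → k) :
      eval Q Δ = (Matrix.of fun i j => differential Q (f i) (u j)).det := by
    rw [hΔ, RingHom.map_det]
    congr 1
    ext i j
    simp [eval_dirDeriv]
  -- Where `Δ` is nonzero, the differentials of the `f i` span the conormal space, by constancy of
  -- its dimension, so Cramer's rule applies. Since `Δ` does not vanish at `P`, primality then
  -- removes it.
  have h1 : Δ * borderedDerivation (fun i => dirDeriv (u i)) f (dirDeriv v) g ∈
      vanishingIdeal k X := by
    intro Q hQ
    rw [map_mul, aeval_eq_eval, mul_eq_zero, or_iff_not_imp_left]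
    intro h0
    rw [eval_borderedDerivation]
    exact det_mul_sub_sum_adjugate_eq_zero ((hs.finrank_conormalSpace_eq hQ hP).trans hcard)
      (fun i => differential_mem_conormalSpace Q (hf i)) u (hev Q ▸ h0)
      (differential_mem_conormalSpace Q hg) v
  refine (hX.isPrime_vanishingIdeal.mem_or_mem h1).resolve_left fun h0 => hdet ?_
  rw [← hev P]
  simpa [aeval_eq_eval] using h0 P hP

end Variety

/-! ### Vector fields as derivations of the coordinate ring -/

section CoordinateRing

variable {k : Type*} [Field k] {n : ℕ} {X : Set (Fin n → k)}

/-- The derivation of the coordinate ring induced by a polynomial vector field tangent to `X`. -/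
def inducedDerivation (μ : tangentFields X) :
    Derivation k (CoordinateRing X) (CoordinateRing X) :=
  let I := (vanishingIdeal k X).restrictScalars k
  let e := Submodule.Quotient.restrictScalarsEquiv k (vanishingIdeal k X)
  let φ : CoordinateRing X →ₗ[k] CoordinateRing X :=
    e.toLinearMap ∘ₗ I.mapQ I (μ.1 : MvPolynomial (Fin n) k →ₗ[k] MvPolynomial (Fin n) k)
      (fun f hf => μ.2 f hf) ∘ₗ e.symm.toLinearMap
  have hφ (f : MvPolynomial (Fin n) k) :
      φ (Ideal.Quotient.mk _ f) = Ideal.Quotient.mk _ (μ.1 f) := rfl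
  Derivation.mk' φ fun a b => by
    obtain ⟨a, rfl⟩ := Ideal.Quotient.mk_surjective a
    obtain ⟨b, rfl⟩ := Ideal.Quotient.mk_surjective b
    rw [← map_mul, hφ, hφ, hφ, Derivation.leibniz]
    simp

@[simp]
lemma inducedDerivation_mk (μ : tangentFields X) (f : MvPolynomial (Fin n) k) :
    inducedDerivation μ (Ideal.Quotient.mk _ f) = Ideal.Quotient.mk _ (μ.1 f) := rfl

lemma derivation_ext_mk {δ ε : Derivation k (CoordinateRing X) (CoordinateRing X)}
    (h : ∀ f : MvPolynomial (Fin n) k, δ (Ideal.Quotient.mk _ f) = ε (Ideal.Quotient.mk _ f)) :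
    δ = ε :=
  Derivation.ext fun a => by
    obtain ⟨a, rfl⟩ := Ideal.Quotient.mk_surjective a
    exact h a

variable (X) in
/-- The homomorphism from the polynomial vector fields tangent to `X` to the derivations of the
coordinate ring of `X`. -/
def toDerivation :
    tangentFields X →ₗ⁅k⁆ Derivation k (CoordinateRing X) (CoordinateRing X) where
  toFun := inducedDerivation
  map_add' μ ν := derivation_ext_mk fun f => by
    rw [Derivation.add_apply]
    simp only [inducedDerivation_mk, ← map_add]
    rfl
  map_smul' c μ := derivation_ext_mk fun f => by
    rw [Derivation.smul_apply]
    rfl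
  map_lie' {μ ν} := derivation_ext_mk fun f => by
    rw [Derivation.commutator_apply]
    simp only [inducedDerivation_mk, ← map_sub]
    rfl

@[simp]
lemma toDerivation_mk (μ : tangentFields X) (f : MvPolynomial (Fin n) k) :
    toDerivation X μ (Ideal.Quotient.mk _ f) = Ideal.Quotient.mk _ (μ.1 f) := rfl

lemma ker_toDerivation : (toDerivation X).ker = vanishingFields X := by
  ext μ
  rw [LieHom.mem_ker]
  constructor
  · intro h f
    have h1 := congr($h (Ideal.Quotient.mk _ f))
    rw [toDerivation_mk] at h1
    exact Ideal.Quotient.eq_zero_iff_mem.1 h1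
  · intro h
    refine derivation_ext_mk fun f => ?_
    rw [toDerivation_mk]
    exact Ideal.Quotient.eq_zero_iff_mem.2 (h f)

/-- Lift the images of the coordinates; the lifted field agrees with `δ` modulo the ideal of `X`, so
it preserves that ideal. -/
lemma toDerivation_surjective : Function.Surjective (toDerivation X) := by
  intro δ
  choose g hg using fun i : Fin n =>
    Ideal.Quotient.mk_surjective (δ (Ideal.Quotient.mk (vanishingIdeal k X) (MvPolynomial.X i)))
  have h (f : MvPolynomial (Fin n) k) :
      Ideal.Quotient.mk (vanishingIdeal k X) (mkDerivation k g f) =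
        δ (Ideal.Quotient.mk (vanishingIdeal k X) f) := by
    induction f using MvPolynomial.induction_on with
    | C a =>
      rw [← algebraMap_eq, Derivation.map_algebraMap, map_zero]
      exact (δ.map_algebraMap a).symm
    | add p q hp hq => simp only [map_add, hp, hq]
    | mul_X p i hp =>
      simp only [Derivation.leibniz, map_add, map_mul, smul_eq_mul, hp, mkDerivation_X, hg]
  refine ⟨⟨mkDerivation k g, fun f hf => ?_⟩, derivation_ext_mk fun f => ?_⟩
  · rw [← Ideal.Quotient.eq_zero_iff_mem, h, Ideal.Quotient.eq_zero_iff_mem.2 hf, map_zero]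
  · rw [toDerivation_mk]
    exact h f

/-! ### Points, Euler fields and derivation-simplicity -/

/-- The maximal ideal of the coordinate ring of `X` of functions vanishing at the point `P`. -/
def pointIdeal (X : Set (Fin n → k)) (P : Fin n → k) : Ideal (CoordinateRing X) :=
  (vanishingIdeal k {P} : Ideal (MvPolynomial (Fin n) k)).map (Ideal.Quotient.mk _)

lemma mk_mem_pointIdeal {P : Fin n → k} (hP : P ∈ X) {f : MvPolynomial (Fin n) k} :
    Ideal.Quotient.mk _ f ∈ pointIdeal X P ↔ eval P f = 0 := by
  have h : vanishingIdeal k X ≤ (vanishingIdeal k {P} : Ideal (MvPolynomial (Fin n) k)) :=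
    vanishingIdeal_anti_mono (Set.singleton_subset_iff.2 hP)
  rw [pointIdeal, Ideal.mem_quotient_iff_mem h]
  simp [aeval_eq_eval]

/-- A proper ideal of the coordinate ring of a variety over an algebraically closed field has a
zero on the variety. -/
lemma exists_le_pointIdeal [IsAlgClosed k] (hX : IsAlgebraic X) {J : Ideal (CoordinateRing X)}
    (hJ : J ≠ ⊤) : ∃ P ∈ X, J ≤ pointIdeal X P := by
  obtain ⟨M, hM, hJM⟩ := Ideal.exists_le_maximal J hJ
  have hM' : (M.comap (Ideal.Quotient.mk (vanishingIdeal k X))).IsMaximal :=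
    Ideal.comap_isMaximal_of_surjective _ Ideal.Quotient.mk_surjective
  obtain ⟨P, hP⟩ := isMaximal_iff_eq_vanishingIdeal_singleton.1 hM'
  have hPX : P ∈ X := by
    rw [← hX.zeroLocus_vanishingIdeal]
    intro f hf
    rw [← mem_vanishingIdeal_singleton_iff, ← hP, Ideal.mem_comap,
      Ideal.Quotient.eq_zero_iff_mem.2 hf]
    exact zero_mem M
  refine ⟨P, hPX, fun a ha => ?_⟩
  obtain ⟨f, rfl⟩ := Ideal.Quotient.mk_surjective a
  rw [mk_mem_pointIdeal hPX]
  have h1 : f ∈ M.comap (Ideal.Quotient.mk (vanishingIdeal k X)) := hJM ha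
  rw [hP, mem_vanishingIdeal_singleton_iff, aeval_eq_eval] at h1
  exact h1

/-- At every point `P` of a smooth variety there are global vector fields `δ j` such that
`∑ (x_j - P_j) δ j` acts as the identity on the cotangent space at `P`. -/
lemma exists_euler (hX : IsIrreducibleVariety X) (hs : IsSmooth X) {P : Fin n → k} (hP : P ∈ X) :
    ∃ δ : Fin n → Derivation k (CoordinateRing X) (CoordinateRing X),
      ∀ a ∈ pointIdeal X P,
        ∑ j, Ideal.Quotient.mk _ (MvPolynomial.X j - C (P j)) * δ j a - a ∈
          pointIdeal X P ^ 2 := by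
  obtain ⟨w, hw, -, hli⟩ :=
    Submodule.exists_fun_fin_finrank_span_eq k (conormalSpace X P : Set (Module.Dual k (Fin n → k)))
  -- The `f i` have differentials forming a basis of the conormal space at `P`; the dual vectors `u`
  -- normalise the Jacobian matrix there to 1.
  choose f hf hfw using hw
  obtain rfl : (fun i => differential P (f i)) = w := funext hfw
  obtain ⟨u, hu⟩ := exists_dual_family hli
  have hone : (Matrix.of fun i j => differential P (f i) (u j)) = 1 := by
    ext i j
    simp [hu, Matrix.one_apply]
  have hτ (v : Fin n → k) :=
    borderedDerivation_mem_tangentFields hX hs hP (by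
      rw [Fintype.card_fin]
      exact congrArg (fun N : Submodule k (Module.Dual k (Fin n → k)) => Module.finrank k N)
        (Submodule.span_eq (conormalSpace X P)).symm) hf u (by simp [hone]) v
  refine ⟨fun j => toDerivation X ⟨_, hτ (Pi.single j 1)⟩, fun a ha => ?_⟩
  obtain ⟨g, rfl⟩ := Ideal.Quotient.mk_surjective a
  rw [mk_mem_pointIdeal hP] at ha
  simp only [toDerivation_mk, ← map_mul, ← map_sum, ← map_sub]
  set τ : Fin n → W k n :=
    fun j => borderedDerivation (fun i => dirDeriv (u i)) f (dirDeriv (Pi.single j 1)) with hτdef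
  -- Subtracting `h` leaves the class of `g` unchanged and kills its derivatives along the `u i` at
  -- `P`. So `τ j g` and the partial derivative of `g - h` agree at `P`, and Taylor's formula for `g
  -- - h` gives the Euler identity.
  set h : MvPolynomial (Fin n) k := ∑ i, C (differential P g (u i)) * f i with hh
  have hhI : h ∈ vanishingIdeal k X := sum_mem fun i _ => Ideal.mul_mem_left _ _ (hf i)
  have hhP : eval P h = 0 := hhI P hP
  have hτP (j : Fin n) : eval P (τ j g) = eval P (pderiv j (g - h)) := by
    rw [hτdef, eval_borderedDerivation, hone]
    simp [← eval_dirDeriv, dirDeriv_single, hh, Matrix.one_apply, mul_comm]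
  have h1 := sub_sum_sub_mem_sq P (g - h)
  have h2 : ∑ j, (MvPolynomial.X j - C (P j)) * (τ j g - C (eval P (τ j g))) ∈
      (vanishingIdeal k {P} : Ideal (MvPolynomial (Fin n) k)) ^ 2 := by
    refine sum_mem fun j _ => ?_
    rw [sq]
    exact Ideal.mul_mem_mul (by simp) (by simp [aeval_eq_eval])
  have h3 : ∑ j, (MvPolynomial.X j - C (P j)) * τ j g - (g - h) ∈
      (vanishingIdeal k {P} : Ideal (MvPolynomial (Fin n) k)) ^ 2 := by
    convert sub_mem h2 h1 using 1
    simp only [hτP, mul_sub, Finset.sum_sub_distrib, map_sub, ha, hhP, map_zero]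
    ring
  have h4 := Ideal.mem_map_of_mem (Ideal.Quotient.mk (vanishingIdeal k X)) h3
  rw [Ideal.map_pow, ← pointIdeal] at h4
  have h5 : Ideal.Quotient.mk (vanishingIdeal k X) h = 0 := Ideal.Quotient.eq_zero_iff_mem.2 hhI
  convert h4 using 1
  rw [map_sub, map_sub _ _ (g - h), map_sub _ g, h5, sub_zero]

/-- The coordinate ring of a smooth irreducible affine variety is derivation-simple. -/
theorem isDerivationSimple_coordinateRing [IsAlgClosed k] [CharZero k]
    (hX : IsIrreducibleVariety X) (hs : IsSmooth X) :
    Derivation.IsDerivationSimple k (CoordinateRing X) := by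
  have := hX.isPrime_vanishingIdeal
  refine fun J hJ => or_iff_not_imp_right.2 fun hJtop => ?_
  obtain ⟨P, hP, hJP⟩ := exists_le_pointIdeal hX.isAlgebraic hJtop
  obtain ⟨δ, hδ⟩ := exists_euler hX hs hP
  refine Derivation.eq_bot_of_euler (fun h => ?_) hJP _ (fun j => ?_) δ hδ fun j => hJ (δ j)
  · have h1 : Ideal.Quotient.mk _ 1 ∈ pointIdeal X P := h ▸ Submodule.mem_top
    rw [mk_mem_pointIdeal hP] at h1
    simp at h1
  · rw [mk_mem_pointIdeal hP]
    simp

/-- A derivation-simple coordinate ring of an algebraic set with at least two points has a nonzero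
derivation. -/
lemma exists_derivation_ne_zero (hA : Derivation.IsDerivationSimple k (CoordinateRing X))
    (hX : X.Nontrivial) : ∃ δ : Derivation k (CoordinateRing X) (CoordinateRing X), δ ≠ 0 := by
  by_contra! h0
  obtain ⟨P, hP, Q, hQ, hPQ⟩ := hX
  obtain ⟨j, hj⟩ := Function.ne_iff.1 hPQ
  -- Without nonzero derivations every ideal is stable, including that of `P`, which is proper and,
  -- because of `Q`, nonzero.
  rcases hA (pointIdeal X P) (fun δ a _ => by simp [h0 δ]) with h | h
  · have h1 : Ideal.Quotient.mk _ (MvPolynomial.X j - C (P j)) ∈ pointIdeal X P := by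
      rw [mk_mem_pointIdeal hP]
      simp
    rw [h, Ideal.mem_bot, Ideal.Quotient.eq_zero_iff_mem] at h1
    have h2 := h1 Q hQ
    simp only [map_sub, aeval_X, aeval_C, Algebra.algebraMap_self, RingHom.id_apply] at h2
    exact hj (sub_eq_zero.1 h2).symm
  · have h1 : Ideal.Quotient.mk _ 1 ∈ pointIdeal X P := h ▸ Submodule.mem_top
    rw [mk_mem_pointIdeal hP] at h1
    simp at h1

end CoordinateRing

end AffineVariety

end

theorem theorem3 {k : Type*} [Field k] [IsAlgClosed k] [CharZero k] {n : ℕ}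
    (X : Set (Fin n → k)) (hX : AffineVariety.IsIrreducibleVariety X)
    (hsmooth : AffineVariety.IsSmooth X) (hpt : X.Nontrivial) :
    LieAlgebra.IsSimple k (AffineVariety.PolyVectorFields X) := by
  have := hX.isPrime_vanishingIdeal
  have hA := AffineVariety.isDerivationSimple_coordinateRing hX hsmooth
  have h := (Derivation.isSimple_of_isDerivationSimple hA
    (AffineVariety.exists_derivation_ne_zero hA hpt)).quotient_ker
    (AffineVariety.toDerivation X) AffineVariety.toDerivation_surjective
  rwa [AffineVariety.ker_toDerivation] at h
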